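/- Let $P$ be a finite $T_0$ space, that is, a finite partially ordered set with the topology whose open sets are the ideals (lower sets), and assume that $P$ is path-connected. Let $\mathcal{K}(P)$ be the order complex of $P$, the simplicial complex whose $n$-simplices are the chains $p_0<\dots<p_n$ in $P$, regarded as a topological space through its geometric realization. Then $$\mathrm{TC}(\mathcal{K}(P)) \le \mathrm{CC}(P).$$ Here, for a path-connected space $X$, $\mathrm{TC}(X)$ is the smallest non-negative integer $n$ such that $X\times X$ has an open cover $\{U_i\}_{i=1}^n$ with, for each $i$, a continuous map $s_i:U_i\to X^{[0,1]}$ (the space of paths in $X$ with the compact-open topology) satisfying $(s_i(x,y)(0),s_i(x,y)(1))=(x,y)$ for all $(x,y)\in U_i$; $\mathrm{TC}(X)=\infty$ if there is no such $n$. For $m\ge 0$ let $J_m$ be the set $\{0,\dots,m\}$ with the zigzag order $0<1>2<\cdots m$, and let $P^{J_m}$ be the finite space of order-preserving maps $J_m\to P$ with the pointwise order. $\mathrm{CC}_m(P)$ is the smallest non-negative integer $n$ such that $P\times P$ has an open cover $\{Q_i\}_{i=1}^n$ with, for each $i$, a continuous map $s_i:Q_i\to P^{J_m}$ satisfying $(s_i(x,y)(0),s_i(x,y)(m))=(x,y)$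 for all $(x,y)\in Q_i$; $\mathrm{CC}_m(P)=\infty$ if there is no such $n$. Finally $\mathrm{CC}(P)=\min_{m\ge 0}\mathrm{CC}_m(P)$. -/

import Mathlib

open scoped unitInterval

/-! ### Topological complexity -/

/-- `X × X` has an open cover by `n` sets, each of which carries a continuous section of the path
fibration `X^I → X × X`, `γ ↦ (γ 0, γ 1)`. The path space `X^I` is `C(I, X)`, with the
compact-open topology. -/
def HasPathSections (X : Type*) [TopologicalSpace X] (n : ℕ) : Prop :=
  ∃ U : Fin n → Set (X × X),
    (∀ i, IsOpen (U i)) ∧ (⋃ i, U i) = Set.univ ∧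
    ∀ i, ∃ s : C(U i, C(I, X)), ∀ z : U i, (s z 0, s z 1) = (z : X × X)

/-- The (unreduced) topological complexity `TC(X)`: the least number of open sets in such a cover,
and `⊤` if there is none. -/
noncomputable def topologicalComplexity (X : Type*) [TopologicalSpace X] : ℕ∞ :=
  ⨅ (n : ℕ) (_ : HasPathSections X n), (n : ℕ∞)

/-! ### Combinatorial complexity -/

/-- The underlying set `{0, …, m}` of the finite fence `J_m`. -/
def Fence (m : ℕ) : Type := Fin (m + 1)

namespace Fence

/-- The index of an element of the fence. -/
def val {m : ℕ} (i : Fence m) : ℕ := Fin.val i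

/-- The zigzag order `0 < 1 > 2 < ⋯ m`: the only strict relations are those of an even element
below the neighbouring odd elements. -/
instance (m : ℕ) : PartialOrder (Fence m) where
  le i j := i = j ∨ (Even i.val ∧ Odd j.val ∧ (i.val + 1 = j.val ∨ j.val + 1 = i.val))
  le_refl i := Or.inl rfl
  le_trans i j k := by
    rintro (rfl | ⟨h1, h2, h3⟩) (rfl | ⟨h4, h5, h6⟩)
    · exact Or.inl rfl
    · exact Or.inr ⟨h4, h5, h6⟩
    · exact Or.inr ⟨h1, h2, h3⟩
    · exact absurd h4 (Nat.not_even_iff_odd.mpr h2)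
  le_antisymm i j := by
    rintro (rfl | ⟨h1, h2, h3⟩) (h | ⟨h4, h5, h6⟩)
    · rfl
    · rfl
    · exact h.symm
    · exact absurd h4 (Nat.not_even_iff_odd.mpr h2)

/-- The initial element `0` of the fence. -/
def first (m : ℕ) : Fence m := (0 : Fin (m + 1))

/-- The final element `m` of the fence. -/
def last (m : ℕ) : Fence m := Fin.last m

end Fence

/-- The finite space `P^{J_m}` of combinatorial paths of length `m` in `P`: order-preserving maps
`J_m → P` with the pointwise order and the topology whose open sets are the ideals (lower sets). -/
abbrev CombinatorialPath (P : Type*) [Preorder P] (m : ℕ) : Type _ :=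
  Topology.WithLowerSet (Fence m →o P)

/-- The endpoint map `q_m : P^{J_m} → P × P`, `γ ↦ (γ 0, γ m)`. -/
def CombinatorialPath.endpoints {P : Type*} [Preorder P] {m : ℕ} (γ : CombinatorialPath P m) :
    P × P :=
  (Topology.WithLowerSet.ofLowerSet γ (Fence.first m),
    Topology.WithLowerSet.ofLowerSet γ (Fence.last m))

/-- `P × P` has an open cover by `n` sets, each of which carries a continuous section of
`q_m : P^{J_m} → P × P`. -/
def HasCombinatorialSections (P : Type*) [TopologicalSpace P] [Preorder P] (m n : ℕ) : Prop :=
  ∃ Q : Fin n → Set (P × P),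
    (∀ i, IsOpen (Q i)) ∧ (⋃ i, Q i) = Set.univ ∧
    ∀ i, ∃ s : C(Q i, CombinatorialPath P m), ∀ z : Q i, (s z).endpoints = (z : P × P)

/-- `CC_m(P)`: the least number of open sets in such a cover, and `⊤` if there is none. -/
noncomputable def combinatorialComplexityAt (P : Type*) [TopologicalSpace P] [Preorder P]
    (m : ℕ) : ℕ∞ :=
  ⨅ (n : ℕ) (_ : HasCombinatorialSections P m n), (n : ℕ∞)

/-- The combinatorial complexity `CC(P)`, the minimum of the `CC_m(P)` over `m ≥ 0`. -/
noncomputable def combinatorialComplexity (P : Type*) [TopologicalSpace P] [Preorder P] : ℕ∞ :=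
  ⨅ m : ℕ, combinatorialComplexityAt P m

/-! ### The order complex -/

/-- The order complex `𝒦(P)`: the simplices are the nonempty finite chains of `P`. -/
def orderComplex (P : Type*) [PartialOrder P] : AbstractSimplicialComplex P where
  faces := {s | s.Nonempty ∧ IsChain (· ≤ ·) (s : Set P)}
  isRelLowerSet_faces := fun _ hs =>
    ⟨hs.1, fun _ hts ht => ⟨ht, hs.2.mono (Finset.coe_subset.mpr hts)⟩⟩
  singleton_mem := fun v => ⟨Finset.singleton_nonempty v, by simp⟩

/-- The geometric realization of an abstract simplicial complex on a finite vertex set `V`, in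
barycentric coordinates: the points of the standard simplex in `V → ℝ` that are supported on
a simplex of the complex. It is used with the subspace topology. -/
def geometricRealization {V : Type*} [Fintype V] (K : AbstractSimplicialComplex V) :
    Set (V → ℝ) :=
  {x | x ∈ stdSimplex ℝ V ∧ ∃ s ∈ K.faces, ∀ v, v ∉ s → x v = 0}

section OrderComplex

variable {P Q A : Type*}

/-! ### Points and maps of the realization of an order complex -/

/-! Over a member `S` of the combinatorial cover, a section is a zigzag of order-preserving maps `S
→ P` from the first projection to the second. Comparable maps induce homotopic maps of order
complexes, so the two projections `𝒦(S) → 𝒦(P)` are homotopic (`realizationMap_homotopic_of_fence`).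

To transport this to `𝒦(P) × 𝒦(P)`, regard a point of `𝒦(P)` as a probability measure on a chain.
The monotone coupling of two such measures varies continuously and is supported on a chain of `P ×
P` (`isChain_support_monotoneCoupling`). Where it charges `S`, an open condition, restricting and
normalizing it gives a map to `𝒦(S)`. Its two marginals need not be the original points, but they
stay in the same simplices, hence are linearly homotopic to them. Concatenating the three homotopies
gives a path section. Every coupling charges some pair, so these open sets cover. -/

theorem mem_geometricRealization_orderComplex [Fintype P] [PartialOrder P] {x : P → ℝ} :
    x ∈ geometricRealization (orderComplex P) ↔
      x ∈ stdSimplex ℝ P ∧ IsChain (· ≤ ·) (Function.support x) := by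
  classical
  constructor
  · rintro ⟨hx, s, hs, hsx⟩
    refine ⟨hx, hs.2.mono fun v hv => ?_⟩
    by_contra h
    exact hv (hsx v h)
  · rintro ⟨hx, hc⟩
    refine ⟨hx, Finset.univ.filter (fun v => x v ≠ 0), ⟨?_, ?_⟩, ?_⟩
    · by_contra h
      rw [Finset.not_nonempty_iff_eq_empty, Finset.filter_eq_empty_iff] at h
      have h0 : ∑ v, x v = 0 := Finset.sum_eq_zero fun v hv => by simpa using h hv
      rw [hx.2] at h0
      exact one_ne_zero h0
    · refine hc.mono fun v hv => ?_
      simpa using hv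
    · intro v hv
      simpa using hv

/-- Two maps into the realization of an order complex are homotopic, by a linear homotopy, if
their values at each point lie in a common simplex. -/
theorem homotopic_of_isChain_support_union [Fintype P] [PartialOrder P] [TopologicalSpace A]
    {f g : C(A, geometricRealization (orderComplex P))}
    (h : ∀ a, IsChain (· ≤ ·) (Function.support (f a).1 ∪ Function.support (g a).1)) :
    f.Homotopic g := by
  refine ⟨⟨⟨fun w => ⟨fun p => (1 - (w.1 : ℝ)) * (f w.2).1 p + w.1 * (g w.2).1 p, ?_⟩, ?_⟩,
    ?_, ?_⟩⟩
  · rw [mem_geometricRealization_orderComplex]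
    refine ⟨convex_stdSimplex ℝ P (f w.2).2.1 (g w.2).2.1 (sub_nonneg.2 w.1.2.2) w.1.2.1
      (sub_add_cancel _ _), (h w.2).mono fun p hp => ?_⟩
    by_contra hn
    simp only [Set.mem_union, Function.mem_support, not_or, not_not] at hn
    exact hp (by simp [hn.1, hn.2])
  · refine Continuous.subtype_mk (continuous_pi fun p => ?_) _
    have hf : Continuous fun w : I × A => (f w.2).1 p :=
      (continuous_apply p).comp (continuous_subtype_val.comp (f.continuous.comp continuous_snd))
    have hg : Continuous fun w : I × A => (g w.2).1 p :=
      (continuous_apply p).comp (continuous_subtype_val.comp (g.continuous.comp continuous_snd))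
    have ht : Continuous fun w : I × A => (w.1 : ℝ) := continuous_subtype_val.comp continuous_fst
    exact ((continuous_const.sub ht).mul hf).add (ht.mul hg)
  · intro a
    ext p
    simp
  · intro a
    ext p
    simp

open Classical in
/-- The pushforward of a weight function on a finite type. -/
noncomputable def pushforward [Fintype Q] (f : Q → P) (x : Q → ℝ) (p : P) : ℝ :=
  ∑ q with f q = p, x q

theorem support_pushforward_subset [Fintype Q] (f : Q → P) (x : Q → ℝ) :
    Function.support (pushforward f x) ⊆ f '' Function.support x := by
  classical
  intro p hp
  obtain ⟨q, hq, hx⟩ := Finset.exists_ne_zero_of_sum_ne_zero hp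
  exact ⟨q, hx, (Finset.mem_filter.1 hq).2⟩

theorem pushforward_mem_stdSimplex [Fintype Q] [Fintype P] (f : Q → P) {x : Q → ℝ}
    (hx : x ∈ stdSimplex ℝ Q) : pushforward f x ∈ stdSimplex ℝ P := by
  classical
  refine ⟨fun p => Finset.sum_nonneg fun q _ => hx.1 q, ?_⟩
  rw [← hx.2]
  exact Finset.sum_fiberwise Finset.univ f x

/-- The map of realizations of order complexes induced by an order-preserving map. -/
noncomputable def realizationMap [Fintype Q] [Fintype P] [PartialOrder Q] [PartialOrder P]
    (f : Q →o P) :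
    C(geometricRealization (orderComplex Q), geometricRealization (orderComplex P)) where
  toFun x := ⟨pushforward f x.1, by
    have hx := mem_geometricRealization_orderComplex.1 x.2
    refine mem_geometricRealization_orderComplex.2 ⟨pushforward_mem_stdSimplex f hx.1, ?_⟩
    exact (f.monotone.isChain_image hx.2).mono
      (support_pushforward_subset f x.1)⟩
  continuous_toFun := by
    refine Continuous.subtype_mk (continuous_pi fun p => ?_) _
    exact continuous_finsetSum _ fun q _ => (continuous_apply q).comp continuous_subtype_val

theorem support_realizationMap_subset [Fintype Q] [Fintype P] [PartialOrder Q] [PartialOrder P]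
    (f : Q →o P) (x : geometricRealization (orderComplex Q)) :
    Function.support (realizationMap f x).1 ⊆ f '' Function.support x.1 :=
  support_pushforward_subset f x.1

/-- For general `f ≤ g` and `q < q'`, the values `g q` and `f q'` may be incomparable. If only one
point is moved, the two images of a chain together form a chain, and the linear homotopy is
available. -/
theorem realizationMap_homotopic_of_eqOn_compl [Fintype Q] [Fintype P] [PartialOrder Q]
    [PartialOrder P] {f g : Q →o P} (hfg : f ≤ g) (q₀ : Q) (h : ∀ q, q ≠ q₀ → f q = g q) :
    (realizationMap f).Homotopic (realizationMap g) := by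
  refine homotopic_of_isChain_support_union fun x => ?_
  have hx := (mem_geometricRealization_orderComplex.1 x.2).2
  have key : ∀ q q', q ≤ q' → f q ≤ g q' ∧ (g q ≤ f q' ∨ f q' ≤ g q) := by
    intro q q' hqq
    refine ⟨(f.monotone hqq).trans (hfg q'), ?_⟩
    by_cases h1 : q = q₀
    · by_cases h2 : q' = q₀
      · subst h1; subst h2; exact Or.inr (hfg _)
      · rw [h q' h2]; exact Or.inl (g.monotone hqq)
    · rw [← h q h1]; exact Or.inl (f.monotone hqq)
  refine IsChain.mono (Set.union_subset_union (support_realizationMap_subset f x)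
    (support_realizationMap_subset g x)) ?_
  have tot : ∀ q ∈ Function.support x.1, ∀ q' ∈ Function.support x.1, q ≤ q' ∨ q' ≤ q :=
    fun q hq q' hq' => hx.total hq hq'
  rintro _ (⟨q, hq, rfl⟩ | ⟨q, hq, rfl⟩) _ (⟨q', hq', rfl⟩ | ⟨q', hq', rfl⟩) -
  · exact (tot q hq q' hq').imp (fun h => f.monotone h) (fun h => f.monotone h)
  · rcases tot q hq q' hq' with h | h
    · exact Or.inl (key q q' h).1
    · exact (key q' q h).2.symm
  · rcases tot q hq q' hq' with h | h
    · exact (key q q' h).2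
    · exact Or.inr (key q' q h).1
  · exact (tot q hq q' hq').imp (fun h => g.monotone h) (fun h => g.monotone h)

/-- Comparable order-preserving maps induce homotopic maps of order complexes. -/
theorem realizationMap_homotopic_of_le [Fintype Q] [Fintype P] [PartialOrder Q] [PartialOrder P]
    {f g : Q →o P} (hfg : f ≤ g) : (realizationMap f).Homotopic (realizationMap g) := by
  classical
  induction hn : (Finset.univ.filter fun q => f q ≠ g q).card using Nat.strong_induction_on
    generalizing f with
  | _ n ih =>
    rcases (Finset.univ.filter fun q => f q ≠ g q).eq_empty_or_nonempty with he | hne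
    · have : f = g := by
        ext q
        simpa using (Finset.filter_eq_empty_iff.1 he) (Finset.mem_univ q)
      rw [this]
    -- Raise `f` to `g` at one point at a time. Maximality of `q₀` keeps the new map monotone: for
    -- `b > q₀`, `g q₀ ≤ g b = f b`.
    · obtain ⟨q₀, hq₀⟩ := Finset.exists_maximal hne
      have hne₀ : f q₀ ≠ g q₀ := (Finset.mem_filter.1 hq₀.1).2
      have hab : ∀ q, q₀ < q → f q = g q := by
        intro q hq
        by_contra hc
        exact hq.not_ge (hq₀.2 (Finset.mem_filter.2 ⟨Finset.mem_univ q, hc⟩) hq.le)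
      let f' : Q →o P := ⟨Function.update f q₀ (g q₀), by
        intro a b hab'
        rcases eq_or_ne a q₀ with rfl | ha
        · rcases eq_or_ne b a with rfl | hb
          · exact le_rfl
          · rw [Function.update_self, Function.update_of_ne hb,
              hab b (lt_of_le_of_ne hab' hb.symm)]
            exact g.monotone hab'
        · rw [Function.update_of_ne ha]
          rcases eq_or_ne b q₀ with rfl | hb
          · rw [Function.update_self]
            exact (hfg a).trans (g.monotone hab')
          · rw [Function.update_of_ne hb]
            exact f.monotone hab'⟩
      have hf'₀ : f' q₀ = g q₀ := Function.update_self q₀ (g q₀) f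
      have hf' : ∀ q, q ≠ q₀ → f' q = f q := fun q hq => Function.update_of_ne hq (g q₀) f
      have hff' : f ≤ f' := by
        intro q
        rcases eq_or_ne q q₀ with rfl | hq
        · rw [hf'₀]; exact hfg q
        · rw [hf' q hq]
      have hf'g : f' ≤ g := by
        intro q
        rcases eq_or_ne q q₀ with rfl | hq
        · rw [hf'₀]
        · rw [hf' q hq]; exact hfg q
      refine (realizationMap_homotopic_of_eqOn_compl hff' q₀ fun q hq => (hf' q hq).symm).trans
        (ih _ ?_ hf'g rfl)
      rw [← hn]
      refine Finset.card_lt_card (Finset.ssubset_iff_of_subset ?_ |>.2 ⟨q₀, hq₀.1, ?_⟩)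
      · intro q hq
        rw [Finset.mem_filter] at hq ⊢
        rcases eq_or_ne q q₀ with rfl | hqq
        · exact absurd hf'₀ hq.2
        · exact ⟨hq.1, hf' q hqq ▸ hq.2⟩
      · simp [hf'₀]

/-! ### The monotone coupling of two points of the realization -/

open Classical in
/-- The mass that a weight function gives to the elements strictly below `p`. -/
noncomputable def massBelow [Fintype P] [PartialOrder P] (x : P → ℝ) (p : P) : ℝ :=
  ∑ q with q < p, x q

/-- The interval of `p` ends before that of `q` begins. -/
theorem massBelow_add_le [Fintype P] [PartialOrder P] {x : P → ℝ} (hx : ∀ p, 0 ≤ x p) {p q : P}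
    (h : p < q) : massBelow x p + x p ≤ massBelow x q := by
  classical
  have hp : p ∉ Finset.univ.filter fun r => r < p := by simp
  unfold massBelow
  rw [add_comm, ← Finset.sum_insert hp]
  refine Finset.sum_le_sum_of_subset_of_nonneg ?_ fun r _ _ => hx r
  intro r hr
  rw [Finset.mem_insert, Finset.mem_filter] at hr
  refine Finset.mem_filter.2 ⟨Finset.mem_univ r, ?_⟩
  rcases hr with rfl | hr
  · exact h
  · exact hr.2.trans h

@[fun_prop]
theorem continuous_massBelow [Fintype P] [PartialOrder P] (p : P) :
    Continuous fun x : P → ℝ => massBelow x p :=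
  continuous_finsetSum _ fun q _ => continuous_apply q

/-- The monotone coupling of two chain-supported weight functions: the weight of `(p, q)` is the
length of the intersection of the intervals of lengths `x p` and `y q` that start at the masses
below `p` and `q`. -/
noncomputable def monotoneCoupling [Fintype P] [PartialOrder P] (x y : P → ℝ) (r : P × P) : ℝ :=
  max 0 (min (massBelow x r.1 + x r.1) (massBelow y r.2 + y r.2) -
    max (massBelow x r.1) (massBelow y r.2))

section Coupling

variable [Fintype P] [PartialOrder P]

theorem monotoneCoupling_nonneg (x y : P → ℝ) (r : P × P) : 0 ≤ monotoneCoupling x y r :=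
  le_max_left _ _

theorem continuous_monotoneCoupling (r : P × P) :
    Continuous fun w : (P → ℝ) × (P → ℝ) => monotoneCoupling w.1 w.2 r := by
  unfold monotoneCoupling
  have h1 := (continuous_massBelow r.1).comp (continuous_fst (X := P → ℝ) (Y := P → ℝ))
  have h2 := (continuous_massBelow r.2).comp (continuous_snd (X := P → ℝ) (Y := P → ℝ))
  have h3 := (continuous_apply (A := fun _ : P => ℝ) r.1).comp
    (continuous_fst (X := P → ℝ) (Y := P → ℝ))
  have h4 := (continuous_apply (A := fun _ : P => ℝ) r.2).comp
    (continuous_snd (X := P → ℝ) (Y := P → ℝ))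
  exact continuous_const.max (((h1.add h3).min (h2.add h4)).sub (h1.max h2))

theorem monotoneCoupling_ne_zero_iff {x y : P → ℝ} {r : P × P} :
    monotoneCoupling x y r ≠ 0 ↔ 0 < x r.1 ∧ massBelow x r.1 < massBelow y r.2 + y r.2 ∧
      massBelow y r.2 < massBelow x r.1 + x r.1 ∧ 0 < y r.2 := by
  rw [← (monotoneCoupling_nonneg x y r).lt_iff_ne', monotoneCoupling, lt_max_iff, sub_pos,
    max_lt_iff, lt_min_iff, lt_min_iff]
  simp only [lt_irrefl, false_or, lt_add_iff_pos_right]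
  tauto

/-- Two charged pairs cannot be crossed: their overlaps would each have to lie to the left of the
other. -/
theorem isChain_support_monotoneCoupling {x y : P → ℝ} (hx : ∀ p, 0 ≤ x p) (hy : ∀ p, 0 ≤ y p)
    (hcx : IsChain (· ≤ ·) (Function.support x)) (hcy : IsChain (· ≤ ·) (Function.support y)) :
    IsChain (· ≤ ·) (Function.support (monotoneCoupling x y)) := by
  have key : ∀ r s : P × P, monotoneCoupling x y r ≠ 0 → monotoneCoupling x y s ≠ 0 →
      r.1 < s.1 → ¬ s.2 < r.2 := by
    intro r s hr hs h1 h2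
    rw [monotoneCoupling_ne_zero_iff] at hr hs
    linarith [massBelow_add_le hx h1, massBelow_add_le hy h2]
  intro r hr s hs _
  have hr' := monotoneCoupling_ne_zero_iff.1 hr
  have hs' := monotoneCoupling_ne_zero_iff.1 hs
  have t1 := hcx.total (x := r.1) (y := s.1) hr'.1.ne' hs'.1.ne'
  have t2 := hcy.total (x := r.2) (y := s.2) hr'.2.2.2.ne' hs'.2.2.2.ne'
  have k1 := key r s hr hs
  have k2 := key s r hs hr
  simp only [Prod.le_def]
  rcases t1 with h1 | h1 <;> rcases t2 with h2 | h2
  · exact Or.inl ⟨h1, h2⟩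
  · rcases h1.eq_or_lt with e1 | l1
    · exact Or.inr ⟨e1.ge, h2⟩
    · rcases h2.eq_or_lt with e2 | l2
      · exact Or.inl ⟨h1, e2.ge⟩
      · exact absurd l2 (k1 l1)
  · rcases h1.eq_or_lt with e1 | l1
    · exact Or.inl ⟨e1.ge, h2⟩
    · rcases h2.eq_or_lt with e2 | l2
      · exact Or.inr ⟨h1, e2.ge⟩
      · exact absurd l2 (k2 l1)
  · exact Or.inr ⟨h1, h2⟩

theorem exists_pos_massBelow_eq_zero {x : P → ℝ}
    (hx : x ∈ geometricRealization (orderComplex P)) : ∃ p, 0 < x p ∧ massBelow x p = 0 := by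
  classical
  obtain ⟨h, -⟩ := mem_geometricRealization_orderComplex.1 hx
  have hne : (Finset.univ.filter fun p => x p ≠ 0).Nonempty := by
    obtain ⟨p, hp, hxp⟩ := Finset.exists_ne_zero_of_sum_ne_zero
      (s := Finset.univ) (f := x) (by rw [h.2]; exact one_ne_zero)
    exact ⟨p, Finset.mem_filter.2 ⟨hp, hxp⟩⟩
  obtain ⟨p, hp⟩ := Finset.exists_minimal hne
  refine ⟨p, (h.1 p).lt_of_ne' (Finset.mem_filter.1 hp.1).2, Finset.sum_eq_zero fun q hq => ?_⟩
  by_contra hc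
  have hqp := (Finset.mem_filter.1 hq).2
  exact hqp.not_ge (hp.2 (Finset.mem_filter.2 ⟨Finset.mem_univ q, hc⟩) hqp.le)

/-- The intervals of the least elements of the two supports both start at `0`, so they overlap. This
suffices for the covering; the total mass of the coupling is not needed. -/
theorem exists_monotoneCoupling_pos {x y : P → ℝ}
    (hx : x ∈ geometricRealization (orderComplex P))
    (hy : y ∈ geometricRealization (orderComplex P)) : ∃ r, 0 < monotoneCoupling x y r := by
  obtain ⟨p, hp, hp0⟩ := exists_pos_massBelow_eq_zero hx
  obtain ⟨q, hq, hq0⟩ := exists_pos_massBelow_eq_zero hy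
  refine ⟨(p, q), (monotoneCoupling_nonneg x y _).lt_of_ne' ?_⟩
  rw [monotoneCoupling_ne_zero_iff]
  simp [hp0, hq0, hp, hq]

/-- The total mass of the monotone coupling on a set `S` of pairs. -/
noncomputable def couplingMass (S : Set (P × P)) [Fintype S]
    (w : geometricRealization (orderComplex P) × geometricRealization (orderComplex P)) : ℝ :=
  ∑ r : S, monotoneCoupling w.1.1 w.2.1 r

/-- The pairs of points whose monotone coupling charges `S`. -/
def couplingDomain (S : Set (P × P)) [Fintype S] :
    Set (geometricRealization (orderComplex P) × geometricRealization (orderComplex P)) :=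
  {w | 0 < couplingMass S w}

theorem continuous_monotoneCoupling_realization (r : P × P) :
    Continuous fun w : geometricRealization (orderComplex P) ×
      geometricRealization (orderComplex P) => monotoneCoupling w.1.1 w.2.1 r :=
  (continuous_monotoneCoupling r).comp
    (continuous_subtype_val.prodMap continuous_subtype_val)

theorem continuous_couplingMass (S : Set (P × P)) [Fintype S] :
    Continuous (couplingMass S) :=
  continuous_finsetSum _ fun r _ => continuous_monotoneCoupling_realization r.1

theorem isOpen_couplingDomain (S : Set (P × P)) [Fintype S] : IsOpen (couplingDomain S) :=
  isOpen_lt continuous_const (continuous_couplingMass S)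

/-- The monotone coupling, restricted to `S` and normalized. -/
noncomputable def restrictedCoupling (S : Set (P × P)) [Fintype S] :
    C(couplingDomain S, geometricRealization (orderComplex S)) where
  toFun w := ⟨fun r => monotoneCoupling w.1.1.1 w.1.2.1 r / couplingMass S w.1, by
    have hw : 0 < couplingMass S w.1 := w.2
    have h1 := mem_geometricRealization_orderComplex.1 w.1.1.2
    have h2 := mem_geometricRealization_orderComplex.1 w.1.2.2
    refine mem_geometricRealization_orderComplex.2 ⟨⟨fun r => div_nonneg
      (monotoneCoupling_nonneg _ _ _) hw.le, ?_⟩, ?_⟩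
    · rw [← Finset.sum_div]
      exact div_self hw.ne'
    · intro r hr s hs hrs
      refine isChain_support_monotoneCoupling h1.1.1 h2.1.1 h1.2 h2.2
        (?_ : r.1 ∈ _) (?_ : s.1 ∈ _) ?_
      · exact fun h => hr (by simp only [h, zero_div])
      · exact fun h => hs (by simp only [h, zero_div])
      · exact fun h => hrs (Subtype.ext h)⟩
  continuous_toFun := by
    refine Continuous.subtype_mk (continuous_pi fun r => ?_) _
    exact ((continuous_monotoneCoupling_realization r.1).comp continuous_subtype_val).div
      ((continuous_couplingMass S).comp continuous_subtype_val) fun w => ne_of_gt w.2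

theorem pos_of_mem_support_restrictedCoupling {S : Set (P × P)} [Fintype S]
    {w : couplingDomain S} {r : S} (hr : r ∈ Function.support (restrictedCoupling S w).1) :
    0 < w.1.1.1 r.1.1 ∧ 0 < w.1.2.1 r.1.2 := by
  have h : monotoneCoupling w.1.1.1 w.1.2.1 r ≠ 0 := fun h =>
    hr (show monotoneCoupling w.1.1.1 w.1.2.1 r / couplingMass S w.1 = 0 by rw [h, zero_div])
  rw [monotoneCoupling_ne_zero_iff] at h
  exact ⟨h.1, h.2.2.2⟩

theorem realizationMap_comp_restrictedCoupling_homotopic {S : Set (P × P)} [Fintype S]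
    (f : S →o P) (g : C(couplingDomain S, geometricRealization (orderComplex P)))
    (h : ∀ w, ∀ r ∈ Function.support (restrictedCoupling S w).1, (g w).1 (f r) ≠ 0) :
    ((realizationMap f).comp (restrictedCoupling S)).Homotopic g := by
  refine homotopic_of_isChain_support_union fun w => ?_
  refine (mem_geometricRealization_orderComplex.1 (g w).2).2.mono (Set.union_subset ?_ subset_rfl)
  refine (support_realizationMap_subset f _).trans ?_
  rintro _ ⟨r, hr, rfl⟩
  exact h w r hr

end Coupling

/-! ### Combinatorial sections give path sections -/

theorem Fence.le_of_even_of_odd {m : ℕ} {i j : Fence m} (hi : Even i.val) (hj : Odd j.val)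
    (h : i.val + 1 = j.val ∨ j.val + 1 = i.val) : i ≤ j :=
  Or.inr ⟨hi, hj, h⟩

/-- A monotone family of combinatorial paths induces a homotopy between its endpoint maps. -/
theorem realizationMap_homotopic_of_fence [Fintype Q] [Fintype P] [PartialOrder Q]
    [PartialOrder P] {m : ℕ} (e : Fence m → Q →o P) (he : Monotone e) :
    (realizationMap (e (Fence.first m))).Homotopic (realizationMap (e (Fence.last m))) := by
  have step : ∀ k (hk : k < m + 1), (realizationMap (e (Fence.first m))).Homotopic
      (realizationMap (e (⟨k, hk⟩ : Fin (m + 1)))) := by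
    intro k
    induction k with
    | zero => exact fun _ => .refl _
    | succ k ih =>
      intro hk
      refine (ih (by omega)).trans ?_
      -- The direction of the comparison alternates along the fence, so odd steps use the reversed
      -- homotopy.
      rcases Nat.even_or_odd k with hev | hodd
      · exact realizationMap_homotopic_of_le
          (he (Fence.le_of_even_of_odd (i := (⟨k, by omega⟩ : Fin (m + 1)))
            (j := (⟨k + 1, hk⟩ : Fin (m + 1))) hev hev.add_one (Or.inl rfl)))
      · exact (realizationMap_homotopic_of_le
          (he (Fence.le_of_even_of_odd (i := (⟨k + 1, hk⟩ : Fin (m + 1)))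
            (j := (⟨k, by omega⟩ : Fin (m + 1))) hodd.add_one hodd (Or.inr rfl)))).symm
  exact step m (Nat.lt_succ_self m)

/-- Continuous maps preserve specialization, which on `S` is computed componentwise in `P × P` and
there is the order. -/
theorem monotone_of_continuous_withLowerSet [PartialOrder P] [TopologicalSpace P]
    [Topology.IsLowerSet P] [Preorder Q] {S : Set (P × P)}
    {f : S → Topology.WithLowerSet Q} (hf : Continuous f) {a b : S} (hab : a ≤ b) :
    Topology.WithLowerSet.ofLowerSet (f a) ≤ Topology.WithLowerSet.ofLowerSet (f b) := by
  rw [Topology.WithLowerSet.ofLowerSet_le_ofLowerSet]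
  refine Specializes.map ?_ hf
  rw [subtype_specializes_iff]
  exact specializes_prod.2 ⟨Topology.IsLowerSet.specializes_iff_le.2 hab.1,
    Topology.IsLowerSet.specializes_iff_le.2 hab.2⟩

/-- A homotopy between the restrictions of the projections to `U` is a section over `U` of the
path fibration. -/
theorem exists_path_section_of_homotopic {X : Type*} [TopologicalSpace X] {U : Set (X × X)}
    (h : (⟨fun z => z.1.1, by fun_prop⟩ : C(U, X)).Homotopic ⟨fun z => z.1.2, by fun_prop⟩) :
    ∃ s : C(U, C(I, X)), ∀ z : U, (s z 0, s z 1) = (z : X × X) := by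
  obtain ⟨H⟩ := h
  refine ⟨(H.toContinuousMap.comp ContinuousMap.prodSwap).curry, fun z => ?_⟩
  exact Prod.ext (H.map_zero_left z) (H.map_one_left z)

theorem HasCombinatorialSections.hasPathSections [Fintype P] [PartialOrder P]
    [TopologicalSpace P] [Topology.IsLowerSet P] {m n : ℕ}
    (h : HasCombinatorialSections P m n) :
    HasPathSections (geometricRealization (orderComplex P)) n := by
  classical
  obtain ⟨S, -, hcov, hs⟩ := h
  have : ∀ i, Fintype (S i) := fun i => Fintype.ofFinite _
  refine ⟨fun i => couplingDomain (S i), fun i => isOpen_couplingDomain _, ?_, fun i => ?_⟩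
  · refine Set.eq_univ_of_forall fun w => ?_
    obtain ⟨r, hr⟩ := exists_monotoneCoupling_pos w.1.2 w.2.2
    obtain ⟨i, hi⟩ := Set.mem_iUnion.1 (hcov.symm ▸ Set.mem_univ r : r ∈ ⋃ i, S i)
    refine Set.mem_iUnion.2 ⟨i, ?_⟩
    exact Finset.sum_pos' (fun r _ => monotoneCoupling_nonneg _ _ _)
      ⟨⟨r, hi⟩, Finset.mem_univ _, hr⟩
  · obtain ⟨s, hs⟩ := hs i
    let e : Fence m → S i →o P := fun j =>
      ⟨fun z => Topology.WithLowerSet.ofLowerSet (s z) j,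
        fun a b hab => monotone_of_continuous_withLowerSet s.continuous hab j⟩
    have he : Monotone e := fun j k hjk z =>
      (Topology.WithLowerSet.ofLowerSet (s z)).monotone hjk
    have hfirst : ∀ z, e (Fence.first m) z = z.1.1 := fun z => congrArg Prod.fst (hs z)
    have hlast : ∀ z, e (Fence.last m) z = z.1.2 := fun z => congrArg Prod.snd (hs z)
    refine exists_path_section_of_homotopic ?_
    -- First point to first marginal, along the fence to the second marginal, then to the second
    -- point.
    refine (realizationMap_comp_restrictedCoupling_homotopic (e (Fence.first m)) _ ?_).symm.trans
      ((ContinuousMap.Homotopic.comp (realizationMap_homotopic_of_fence e he) (.refl _)).trans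
        (realizationMap_comp_restrictedCoupling_homotopic (e (Fence.last m)) _ ?_))
    · intro w r hr
      rw [hfirst]
      exact (pos_of_mem_support_restrictedCoupling hr).1.ne'
    · intro w r hr
      rw [hlast]
      exact (pos_of_mem_support_restrictedCoupling hr).2.ne'

end OrderComplex

theorem theorem4 (P : Type*) [Fintype P] [PartialOrder P] [TopologicalSpace P]
    [Topology.IsLowerSet P] [PathConnectedSpace P] :
    topologicalComplexity (geometricRealization (orderComplex P)) ≤
      combinatorialComplexity P :=
  le_iInf fun _ => le_iInf fun n => le_iInf fun h =>
    iInf₂_le (f := fun (n : ℕ) (_ : HasPathSections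
      (geometricRealization (orderComplex P)) n) => (n : ℕ∞)) n h.hasPathSections
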